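/- Let $d\ge 1$ and let $\lambda_1\ge\lambda_2\ge\dots\ge\lambda_d>0$ with $\sum_{i=1}^d\lambda_i=1$. Put $$a=\frac d4\lambda_d,\qquad z_i=\frac1{d+1}\cdot\frac{\sqrt{\lambda_d}}2\Bigl(\sqrt{\lambda_i}-\frac12\sqrt{\lambda_d}\Bigr)\quad(i=1,\dots,d),$$ let $e\in\mathbb R^d$ be the all-ones column vector, and define the $2d\times2d$ matrix $R$ and the $3d\times 3d$ matrix $Q$ by $$R=\frac1{d(d+1)^2}\begin{pmatrix}d^2I_d& ee^T\\ ee^T& I_d\end{pmatrix},\qquad Q=\begin{pmatrix}aR&\begin{pmatrix}ez^T\\ \mathrm{diag}(z)\end{pmatrix}\\ \begin{pmatrix}ze^T&\mathrm{diag}(z)\end{pmatrix}&\frac{d(d+1)^2}{a}\,\mathrm{diag}(z)^2\end{pmatrix}.$$ Say that a state (density matrix) $\rho$ on $\mathbb C^d\otimes\mathbb C^d$ has the form $(\ast)$ if $\rho=|\psi\rangle\langle\psi|$ is pure with Schmidt coefficients $\sqrt{\lambda_i}$, that is, $|\psi\rangle=\sum_{i=1}^d\sqrt{\lambda_i}\,|\alpha_i\rangle\otimes|\beta_i\rangle$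 for some orthonormal families $(\alpha_i)$, $(\beta_i)$ of $\mathbb C^d$. Then: (1) $Q$ is a correlation, i.e. it has nonnegative entries with sum $1$. Every $3d\times3d$ matrix $P$ with nonnegative entries of sum $1$ satisfies $$\sum_{x,y=1}^{3d}\sqrt{P_{xy}}\sqrt{Q_{xy}}\le1,$$ with equality if and only if $P=Q$. (2) For every state $\rho$ of the form $(\ast)$ there are POVMs $(A_x)_{x=1}^{3d}$ and $(B_y)_{y=1}^{3d}$ on $\mathbb C^d$ such that $\mathrm{tr}(\rho(A_x\otimes B_y))=Q_{xy}$ for all $x,y$. (3) Conversely, if $\rho$ is any (possibly mixed) state on $\mathbb C^d\otimes\mathbb C^d$ and $(A_x)_{x=1}^{3d}$, $(B_y)_{y=1}^{3d}$ are any POVMs on $\mathbb C^d$ such that the correlation $P_{xy}=\mathrm{tr}(\rho(A_x\otimes B_y))$ saturates the inequality in (1), then $\rho$ has the form $(\ast)$. -/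

import Mathlib

open scoped Matrix Kronecker ComplexOrder

namespace SemiSelfTest

/-- The labels of the `3d` outcomes of a measurement, in three consecutive groups of size `d`. -/
abbrev Outcome (d : ℕ) : Type := (Fin d ⊕ Fin d) ⊕ Fin d

/-- A density matrix. -/
def IsState {n : Type*} [Fintype n] (ρ : Matrix n n ℂ) : Prop :=
  ρ.PosSemidef ∧ ρ.trace = 1

/-- A POVM on `ℂ^n` with finite outcome set `ι`. -/
def IsPOVM {ι n : Type*} [Fintype ι] [DecidableEq n] (A : ι → Matrix n n ℂ) : Prop :=
  (∀ x, (A x).PosSemidef) ∧ ∑ x, A x = 1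

/-- The matrix of outcome probabilities `tr(ρ (A_x ⊗ B_y))`. For a state and two POVMs these traces
are real (and nonnegative), so taking the real part loses nothing. -/
noncomputable def correlation {ι κ m n : Type*} [Fintype m] [Fintype n]
    (ρ : Matrix (m × n) (m × n) ℂ) (A : ι → Matrix m m ℂ) (B : κ → Matrix n n ℂ) :
    Matrix ι κ ℝ :=
  Matrix.of fun x y => (ρ * (A x ⊗ₖ B y)).trace.re

/-- A joint probability distribution of two outcomes, as a matrix. -/
def IsCorrelation {ι κ : Type*} [Fintype ι] [Fintype κ] (P : Matrix ι κ ℝ) : Prop :=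
  (∀ x y, 0 ≤ P x y) ∧ ∑ x, ∑ y, P x y = 1

/-- The vector `∑ i, s i • (α i ⊗ β i)` of `ℂ^d ⊗ ℂ^d`, in coordinates. -/
noncomputable def schmidtVector {d : ℕ} (s : Fin d → ℝ)
    (α β : Fin d → EuclideanSpace ℂ (Fin d)) : Fin d × Fin d → ℂ :=
  fun p => ∑ i, (s i : ℂ) * α i p.1 * β i p.2

/-- `ρ = |ψ⟩⟨ψ|` for a vector `ψ` with Schmidt decomposition `ψ = ∑ i, s i • (α i ⊗ β i)`. -/
def IsPureWithSchmidtCoefficients {d : ℕ} (ρ : Matrix (Fin d × Fin d) (Fin d × Fin d) ℂ)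
    (s : Fin d → ℝ) : Prop :=
  ∃ α β : Fin d → EuclideanSpace ℂ (Fin d), Orthonormal ℂ α ∧ Orthonormal ℂ β ∧
    ρ = Matrix.vecMulVec (schmidtVector s α β) (star (schmidtVector s α β))

/-- The `2d × 2d` correlation
`P = 1/(d(d+1)²) * [[d² I, e eᵀ], [e eᵀ, I]]`, with `e` the all-ones vector. -/
noncomputable def corrP (d : ℕ) : Matrix (Fin d ⊕ Fin d) (Fin d ⊕ Fin d) ℝ :=
  (1 / ((d : ℝ) * ((d : ℝ) + 1) ^ 2)) •
    Matrix.fromBlocks (((d : ℝ) ^ 2) • (1 : Matrix (Fin d) (Fin d) ℝ)) (Matrix.vecMulVec 1 1)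
      (Matrix.vecMulVec 1 1) 1

/-- The `3d × 3d` correlation
`Q = [[a P, (e zᵀ ; diag z)], [(z eᵀ , diag z), (d(d+1)²/a) (diag z)²]]`. -/
noncomputable def corrQ (d : ℕ) (a : ℝ) (z : Fin d → ℝ) : Matrix (Outcome d) (Outcome d) ℝ :=
  Matrix.fromBlocks (a • corrP d)
    (Matrix.fromRows (Matrix.vecMulVec 1 z) (Matrix.diagonal z))
    (Matrix.fromCols (Matrix.vecMulVec z 1) (Matrix.diagonal z))
    (((d : ℝ) * ((d : ℝ) + 1) ^ 2 / a) • Matrix.diagonal z ^ 2)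

end SemiSelfTest

namespace SemiSelfTest

open Matrix

/-! Write `s i = √λ_i` and `r = √λ_d / 2`, so that `a = d r²` and `z i = r (s i - r) / (d + 1)`. The
inequality is Cauchy–Schwarz for square roots of distributions, so saturation means `P = Q`.

To generate `Q`, each party splits every basis direction with weights `m i ^ 2 = r / s i` and `n i ^
2 = 1 - r / s i`. The `m`-branch of both parties is the flat vector `r ∑ e_i ⊗ e_i`. On it a Fourier
basis and the standard basis are mixed with weights `d/(d+1)` and `1/(d+1)`; the `n`-branch uses the
standard basis (`normSq_sum_measVec`).

For the converse, the zeros of the two diagonal blocks of `aR` force the first two groups of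
operators to have rank one (`exists_isUnit_eq_ketBra`). In the possibly non-orthogonal bases given
by the second groups, the state is supported on the vectors `e_i ⊗ e_i`. The remaining entries of
`aR` make it a rank-one matrix of phases and the first groups complex Hadamard matrices
(`exists_eq_ketBra_diagVec`). A Hadamard group sums to `d` times the sum of the second group, and
the third group is proportional to the second, so completeness fixes the lengths and orthogonality
of the bases (`mul_diagonal_mul_conjTranspose_eq_one`). Those lengths are the Schmidt coefficients.
-/

/-- The coordinates of the product vector `u ⊗ v`. -/
def tensorVec {m n : Type*} (u : m → ℂ) (v : n → ℂ) : m × n → ℂ := fun p => u p.1 * v p.2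

/-- The rank-one matrix `|u⟩⟨u|`. -/
def ketBra {n : Type*} (u : n → ℂ) : Matrix n n ℂ := vecMulVec u (star u)

theorem posSemidef_ketBra {n : Type*} [Fintype n] (u : n → ℂ) : (ketBra u).PosSemidef :=
  posSemidef_vecMulVec_self_star u

theorem ketBra_kronecker {m n : Type*} (u : m → ℂ) (v : n → ℂ) :
    ketBra u ⊗ₖ ketBra v = ketBra (tensorVec u v) := by
  ext p q
  simp only [ketBra, tensorVec, kroneckerMap_apply, vecMulVec_apply, Pi.star_apply, star_mul']
  ring

theorem trace_mul_ketBra {n : Type*} [Fintype n] (M : Matrix n n ℂ) (u : n → ℂ) :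
    (M * ketBra u).trace = star u ⬝ᵥ (M *ᵥ u) := by
  rw [ketBra, mul_vecMulVec, trace_vecMulVec, dotProduct_comm]

theorem kronecker_mulVec_tensorVec {m n m' n' : Type*} [Fintype m] [Fintype n]
    (U : Matrix m' m ℂ) (W : Matrix n' n ℂ) (u : m → ℂ) (v : n → ℂ) :
    (U ⊗ₖ W) *ᵥ tensorVec u v = tensorVec (U *ᵥ u) (W *ᵥ v) := by
  ext p
  simp only [mulVec, dotProduct, tensorVec, kroneckerMap_apply, Fintype.sum_prod_type,
    Finset.sum_mul_sum]
  exact Finset.sum_congr rfl fun i _ => Finset.sum_congr rfl fun j _ => by ring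

theorem mul_ketBra_mul_conjTranspose {m n : Type*} [Fintype n] (U : Matrix m n ℂ) (u : n → ℂ) :
    U * ketBra u * Uᴴ = ketBra (U *ᵥ u) := by
  rw [ketBra, ketBra, mul_vecMulVec, vecMulVec_mul, star_mulVec]

/-! ### The inequality -/

/-- Cauchy–Schwarz for the square roots of two distributions, with the case of equality. -/
theorem sum_sqrt_mul_sqrt_le_one {ι : Type*} [Fintype ι] (p q : ι → ℝ)
    (hp : ∀ i, 0 ≤ p i) (hq : ∀ i, 0 ≤ q i) (hp1 : ∑ i, p i = 1) (hq1 : ∑ i, q i = 1) :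
    ∑ i, √(p i) * √(q i) ≤ 1 ∧ (∑ i, √(p i) * √(q i) = 1 ↔ p = q) := by
  -- The deficit in the inequality is half a sum of squares, which settles the equality case too.
  have key : ∑ i, (√(p i) - √(q i)) ^ 2 = 2 - 2 * ∑ i, √(p i) * √(q i) := by
    have : ∀ i, (√(p i) - √(q i)) ^ 2 = p i + q i - 2 * (√(p i) * √(q i)) := fun i => by
      rw [sub_sq, Real.sq_sqrt (hp i), Real.sq_sqrt (hq i)]; ring
    simp only [this, Finset.sum_sub_distrib, Finset.sum_add_distrib, ← Finset.mul_sum, hp1, hq1]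
    ring
  have hnn : ∀ i ∈ Finset.univ, 0 ≤ (√(p i) - √(q i)) ^ 2 := fun i _ => sq_nonneg _
  refine ⟨by linarith [Finset.sum_nonneg hnn], fun h => ?_, ?_⟩
  · rw [h] at key
    have h0 := (Finset.sum_eq_zero_iff_of_nonneg hnn).1 (by linarith)
    ext i
    have := pow_eq_zero_iff two_ne_zero |>.1 (h0 i (Finset.mem_univ i))
    exact (Real.sqrt_inj (hp i) (hq i)).1 (sub_eq_zero.1 this)
  · rintro rfl
    simp only [Real.mul_self_sqrt (hp _), hp1]

theorem IsCorrelation.sum_sqrt_mul_sqrt_le_one {ι κ : Type*} [Fintype ι] [Fintype κ]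
    {P Q : Matrix ι κ ℝ} (hP : IsCorrelation P) (hQ : IsCorrelation Q) :
    ∑ x, ∑ y, √(P x y) * √(Q x y) ≤ 1 ∧ (∑ x, ∑ y, √(P x y) * √(Q x y) = 1 ↔ P = Q) := by
  have h := SemiSelfTest.sum_sqrt_mul_sqrt_le_one (fun p : ι × κ => P p.1 p.2)
    (fun p => Q p.1 p.2) (fun p => hP.1 _ _) (fun p => hQ.1 _ _)
    (by rw [Fintype.sum_prod_type]; exact hP.2) (by rw [Fintype.sum_prod_type]; exact hQ.2)
  simp only [Fintype.sum_prod_type] at h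
  refine ⟨h.1, h.2.trans ⟨fun h => ?_, fun h => by rw [h]⟩⟩
  ext x y
  exact congrFun h (x, y)

/-! ### The correlation `Q` -/

section Entries

variable {d : ℕ} (a : ℝ) (z : Fin d → ℝ)

theorem corrQ_first_first (i j : Fin d) : corrQ d a z (.inl (.inl i)) (.inl (.inl j)) =
    if i = j then a * d ^ 2 / (d * (d + 1) ^ 2) else 0 := by
  simp only [corrQ, corrP, fromBlocks_apply₁₁, Matrix.smul_apply, one_apply, smul_eq_mul]
  split_ifs <;> ring

theorem corrQ_first_second (i j : Fin d) : corrQ d a z (.inl (.inl i)) (.inl (.inr j)) =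
    a / (d * (d + 1) ^ 2) := by
  simp [corrQ, corrP, div_eq_mul_inv]

theorem corrQ_second_first (i j : Fin d) : corrQ d a z (.inl (.inr i)) (.inl (.inl j)) =
    a / (d * (d + 1) ^ 2) := by
  simp [corrQ, corrP, div_eq_mul_inv]

theorem corrQ_second_second (i j : Fin d) : corrQ d a z (.inl (.inr i)) (.inl (.inr j)) =
    if i = j then a / (d * (d + 1) ^ 2) else 0 := by
  simp only [corrQ, corrP, fromBlocks_apply₁₁, fromBlocks_apply₂₂, Matrix.smul_apply, one_apply,
    smul_eq_mul]
  split_ifs <;> ring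

theorem corrQ_first_third (i j : Fin d) : corrQ d a z (.inl (.inl i)) (.inr j) = z j := by
  simp [corrQ]

theorem corrQ_third_first (i j : Fin d) : corrQ d a z (.inr i) (.inl (.inl j)) = z i := by
  simp [corrQ]

theorem corrQ_second_third (i j : Fin d) : corrQ d a z (.inl (.inr i)) (.inr j) =
    if i = j then z i else 0 := by
  simp [corrQ, diagonal_apply]

theorem corrQ_third_second (i j : Fin d) : corrQ d a z (.inr i) (.inl (.inr j)) =
    if i = j then z i else 0 := by
  simp [corrQ, diagonal_apply]

theorem corrQ_third_third (i j : Fin d) : corrQ d a z (.inr i) (.inr j) =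
    if i = j then d * (d + 1) ^ 2 / a * z i ^ 2 else 0 := by
  simp [corrQ, diagonal_pow, diagonal_apply]

/-- Symmetry lets structural results about `A` be applied to `B` after swapping the factors. -/
theorem corrQ_transpose : (corrQ d a z)ᵀ = corrQ d a z := by
  ext ((i | i) | i) ((j | j) | j) <;>
    simp only [transpose_apply, corrQ_first_first, corrQ_first_second, corrQ_first_third,
      corrQ_second_first, corrQ_second_second, corrQ_second_third, corrQ_third_first,
      corrQ_third_second, corrQ_third_third, eq_comm (a := j)] <;>
    split_ifs with h <;> simp [h]

theorem sum_corrQ (hd : 0 < d) : ∑ x, ∑ y, corrQ d a z x y =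
    a + 2 * (d + 1) * ∑ i, z i + d * (d + 1) ^ 2 / a * ∑ i, z i ^ 2 := by
  have : (d : ℝ) ≠ 0 := by positivity
  have : (d : ℝ) + 1 ≠ 0 := by positivity
  simp only [Fintype.sum_sum_type, corrQ_first_first, corrQ_first_second, corrQ_first_third,
      corrQ_second_first, corrQ_second_second, corrQ_second_third, corrQ_third_first,
      corrQ_third_second, corrQ_third_third, Finset.sum_add_distrib, Finset.sum_ite_eq,
      Finset.mem_univ, if_true, Finset.sum_const, Finset.card_univ, Fintype.card_fin,
      nsmul_eq_mul, ← Finset.mul_sum]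
  field_simp
  ring

theorem corrQ_nonneg (ha : 0 ≤ a) (hz : ∀ i, 0 ≤ z i) (x y : Outcome d) :
    0 ≤ corrQ d a z x y := by
  rcases x with (i | i) | i <;> rcases y with (j | j) | j <;>
    simp only [corrQ_first_first, corrQ_first_second, corrQ_first_third,
      corrQ_second_first, corrQ_second_second, corrQ_second_third, corrQ_third_first,
      corrQ_third_second, corrQ_third_third] <;>
    first
    | exact hz _
    | positivity
    | (split_ifs <;> first | exact hz _ | positivity)

end Entries

/-! ### Measuring a pure state -/

theorem conjTranspose_mul_of_orthonormal {d : ℕ} {α : Fin d → EuclideanSpace ℂ (Fin d)}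
    (hα : Orthonormal ℂ α) :
    (Matrix.of fun p i => α i p)ᴴ * (Matrix.of fun p i => α i p) = 1 := by
  ext i j
  have := orthonormal_iff_ite.1 hα i j
  rw [PiLp.inner_apply] at this
  simp only [mul_apply, conjTranspose_apply, of_apply, one_apply, ← this]
  exact Finset.sum_congr rfl fun p _ => by simp [mul_comm]

theorem orthonormal_of_conjTranspose_mul {d : ℕ} {E : Matrix (Fin d) (Fin d) ℂ}
    (hE : Eᴴ * E = 1) :
    Orthonormal ℂ fun i => (WithLp.toLp 2 fun p => E p i : EuclideanSpace ℂ (Fin d)) := by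
  rw [orthonormal_iff_ite]
  intro i j
  have := congrFun (congrFun hE i) j
  rw [PiLp.inner_apply, ← one_apply, ← this, mul_apply]
  exact Finset.sum_congr rfl fun p _ => by simp [mul_comm]

theorem schmidtVector_eq_mulVec {d : ℕ} (s : Fin d → ℝ)
    (α β : Fin d → EuclideanSpace ℂ (Fin d)) :
    schmidtVector s α β = ((Matrix.of fun p i => α i p) ⊗ₖ (Matrix.of fun p i => β i p)) *ᵥ
      fun p => if p.1 = p.2 then (s p.1 : ℂ) else 0 := by
  ext p
  simp only [schmidtVector, mulVec, dotProduct, kroneckerMap_apply, of_apply,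
    Fintype.sum_prod_type, mul_ite, mul_zero, Finset.sum_ite_eq, Finset.mem_univ, if_true]
  exact Finset.sum_congr rfl fun i _ => by ring

/-- The quadratic form of `|φ⟩⟨φ|`. -/
theorem star_dotProduct_ketBra_mulVec {n : Type*} [Fintype n] (φ w : n → ℂ) :
    star w ⬝ᵥ (ketBra φ *ᵥ w) = (Complex.normSq (star w ⬝ᵥ φ) : ℂ) := by
  have h : star φ ⬝ᵥ w = star (star w ⬝ᵥ φ) := by rw [star_dotProduct]
  rw [ketBra, vecMulVec_mulVec, Complex.normSq_eq_conj_mul_self, ← Complex.star_def, ← h,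
    dotProduct_smul, MulOpposite.smul_eq_mul_unop, MulOpposite.unop_op, mul_comm]

/-- The local unitaries cancel, leaving the squared overlap of `u x ⊗ v y` with `∑ s i • (e_i ⊗
e_i)`. -/
theorem correlation_schmidt_ketBra {d : ℕ} {ι κ : Type*} (s : Fin d → ℝ)
    {α β : Fin d → EuclideanSpace ℂ (Fin d)} (hα : Orthonormal ℂ α) (hβ : Orthonormal ℂ β)
    (u : ι → Fin d → ℂ) (v : κ → Fin d → ℂ) (x : ι) (y : κ) :
    correlation (ketBra (schmidtVector s α β))
      (fun x => ketBra ((Matrix.of fun p i => α i p) *ᵥ u x))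
      (fun y => ketBra ((Matrix.of fun p i => β i p) *ᵥ v y)) x y =
      Complex.normSq (∑ i, s i * (star (u x i) * star (v y i))) := by
  rw [correlation, of_apply, ketBra_kronecker, trace_mul_ketBra, ← kronecker_mulVec_tensorVec,
    star_dotProduct_ketBra_mulVec, Complex.ofReal_re, star_mulVec, ← dotProduct_mulVec,
    schmidtVector_eq_mulVec, mulVec_mulVec, conjTranspose_kronecker, ← mul_kronecker_mul,
    conjTranspose_mul_of_orthonormal hα, conjTranspose_mul_of_orthonormal hβ, one_kronecker_one,
    one_mulVec]
  congr 1
  simp only [dotProduct, Fintype.sum_prod_type, mul_ite, mul_zero, Finset.sum_ite_eq,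
    Finset.mem_univ, if_true, tensorVec, Pi.star_apply, star_mul']
  exact Finset.sum_congr rfl fun i _ => by ring

theorem isPOVM_ketBra {d : ℕ} {ι : Type*} [Fintype ι] {E : Matrix (Fin d) (Fin d) ℂ}
    (hE : Eᴴ * E = 1) (u : ι → Fin d → ℂ) (hu : ∑ x, ketBra (u x) = 1) :
    IsPOVM fun x => ketBra (E *ᵥ u x) := by
  refine ⟨fun x => posSemidef_ketBra _, ?_⟩
  simp only [← mul_ketBra_mul_conjTranspose, ← Finset.sum_mul, ← Finset.mul_sum, hu, mul_one]
  exact mul_eq_one_comm.1 hE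

/-! ### The measurement vectors -/

theorem if_congr_of_imp {α : Type*} {p : Prop} [Decidable p] {x y z : α} (h : p → x = y) :
    (if p then x else z) = if p then y else z := by
  split_ifs with hp
  exacts [h hp, rfl]

/-- Orthogonality of the characters of `ℤ/d`. -/
theorem sum_star_pow_mul_pow {d : ℕ} {ω : ℂ} (hω : IsPrimitiveRoot ω d) (j k : Fin d) :
    ∑ i : Fin d, star (ω ^ (j * i : ℕ)) * ω ^ (k * i : ℕ) = if j = k then (d : ℂ) else 0 := by
  have hd : d ≠ 0 := (Nat.zero_lt_of_lt j.2).ne'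
  have hnorm : ω * star ω = 1 := by
    rw [Complex.star_def, Complex.mul_conj, Complex.normSq_eq_norm_sq, hω.norm'_eq_one hd]; simp
  have hne : ∀ n : ℕ, ω ^ n * star ω ^ n = 1 := fun n => by rw [← mul_pow, hnorm, one_pow]
  have : ∀ i : Fin d, star (ω ^ (j * i : ℕ)) * ω ^ (k * i : ℕ) =
      (star ω ^ (j : ℕ) * ω ^ (k : ℕ)) ^ (i : ℕ) := fun i => by
    rw [star_pow, mul_pow, pow_mul, pow_mul]
  rw [Finset.sum_congr rfl fun i _ => this i,
    Fin.sum_univ_eq_sum_range (fun i => (star ω ^ (j : ℕ) * ω ^ (k : ℕ)) ^ i)]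
  split_ifs with h
  · rw [h]
    simp only [mul_comm (star ω ^ _), hne, one_pow]
    simp
  · set ζ := star ω ^ (j : ℕ) * ω ^ (k : ℕ) with hζ
    have hζd : ζ ^ d = 1 := by
      rw [hζ, mul_pow, ← pow_mul, ← pow_mul, mul_comm, mul_comm (k : ℕ), mul_comm (j : ℕ),
        pow_mul, pow_mul, ← star_pow, hω.pow_eq_one]
      simp
    have hζ1 : ζ ≠ 1 := fun h1 => by
      apply h
      have : ω ^ (k : ℕ) = ω ^ (j : ℕ) := by
        calc ω ^ (k : ℕ) = (ω ^ (j : ℕ) * star ω ^ (j : ℕ)) * ω ^ (k : ℕ) := by rw [hne, one_mul]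
          _ = ω ^ (j : ℕ) * ζ := by rw [hζ]; ring
          _ = _ := by rw [h1, mul_one]
      exact Fin.ext (hω.pow_inj k.2 j.2 this).symm
    have := mul_geom_sum ζ d
    rw [hζd, sub_self] at this
    exact (mul_eq_zero.1 this).resolve_left (sub_ne_zero.2 hζ1)

/-- The vectors of the `3d` rank-one measurement operators: a Fourier basis and the standard basis,
both damped by `m`, and the standard basis with the remaining weights `n`. -/
noncomputable def measVec {d : ℕ} (ω : ℂ) (m n : Fin d → ℝ) : Outcome d → Fin d → ℂ
  | .inl (.inl j) => fun i => (√(1 / ((d : ℝ) + 1)) * m i : ℝ) * ω ^ (j * i : ℕ)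
  | .inl (.inr j) => Pi.single j ((√(1 / ((d : ℝ) + 1)) * m j : ℝ) : ℂ)
  | .inr j => Pi.single j (n j : ℂ)

/-- With conjugate vectors on the second side, the overlap becomes a Hermitian pairing weighted by
`s`, to which character orthogonality applies. -/
theorem measVec_star {d : ℕ} (ω : ℂ) (m n : Fin d → ℝ) (x : Outcome d) :
    measVec (star ω) m n x = star (measVec ω m n x) := by
  rcases x with (j | j) | j <;> ext i <;>
    simp only [measVec, Pi.single_apply, Pi.star_apply, apply_ite star, star_zero, star_mul',
      star_pow, Complex.star_def, Complex.conj_ofReal]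

theorem sum_ketBra_measVec {d : ℕ} {ω : ℂ} (hω : IsPrimitiveRoot ω d) {m n : Fin d → ℝ}
    (hmn : ∀ i, m i ^ 2 + n i ^ 2 = 1) : ∑ x, ketBra (measVec ω m n x) = 1 := by
  have hpos : (0 : ℝ) < d + 1 := by positivity
  have hs : √(1 / ((d : ℝ) + 1)) ^ 2 = 1 / ((d : ℝ) + 1) := Real.sq_sqrt (by positivity)
  set c := √(1 / ((d : ℝ) + 1)) with hc
  ext p q
  -- The Fourier vectors contribute `d/(d+1)` of `m p ^ 2`, the damped standard vectors the
  -- remaining `1/(d+1)`.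
  have h1 : ∑ j : Fin d, ketBra (measVec ω m n (.inl (.inl j))) p q =
      if p = q then ((c ^ 2 * m p ^ 2 * d : ℝ) : ℂ) else 0 := by
    have : ∀ j : Fin d, ketBra (measVec ω m n (.inl (.inl j))) p q =
        (c ^ 2 * m p * m q : ℝ) * (star (ω ^ (q * j : ℕ)) * ω ^ (p * j : ℕ)) := fun j => by
      simp only [ketBra, vecMulVec_apply, measVec, Pi.star_apply, star_mul', ← hc]
      rw [mul_comm (q : ℕ), mul_comm (p : ℕ), Complex.star_def, Complex.conj_ofReal]
      push_cast; ring
    rw [Finset.sum_congr rfl fun j _ => this j, ← Finset.mul_sum, sum_star_pow_mul_pow hω]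
    by_cases h : p = q
    · subst h; simp only [if_true]; push_cast; ring
    · rw [if_neg h, if_neg (Ne.symm h), mul_zero]
  have h2 : ∀ (f : Fin d → ℝ), ∑ j : Fin d, ketBra (Pi.single j (f j : ℂ)) p q =
      if p = q then ((f p ^ 2 : ℝ) : ℂ) else 0 := fun f => by
    simp only [ketBra, vecMulVec_apply, Pi.star_apply, Pi.single_apply]
    by_cases h : p = q
    · subst h; simp [sq]
    · simp only [if_neg h]
      refine Finset.sum_eq_zero fun j _ => ?_
      by_cases hj : p = j
      · rw [if_neg (fun h' : q = j => h (hj.trans h'.symm))]; simp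
      · rw [if_neg hj, zero_mul]
  rw [Matrix.sum_apply, Fintype.sum_sum_type, Fintype.sum_sum_type, h1]
  simp only [measVec, ← hc]
  rw [h2 (fun j => c * m j), h2, one_apply]
  split_ifs with h
  · norm_cast
    rw [mul_pow, hs]
    have := hmn p
    field_simp
    nlinarith
  · simp

theorem normSq_sum_measVec {d : ℕ} {ω : ℂ} (hω : IsPrimitiveRoot ω d) {s m n : Fin d → ℝ} {r : ℝ}
    (hd : 0 < d) (hr : 0 < r) (hm : ∀ i, s i * m i ^ 2 = r) (hmn : ∀ i, m i ^ 2 + n i ^ 2 = 1)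
    (x y : Outcome d) :
    Complex.normSq (∑ i, s i * (star (measVec ω m n x i) * star (measVec (star ω) m n y i))) =
      corrQ d (d * r ^ 2) (fun i => 1 / ((d : ℝ) + 1) * r * (s i - r)) x y := by
  have hpos : (0 : ℝ) < d + 1 := by positivity
  have hd' : (0 : ℝ) < d := by positivity
  set c := √(1 / ((d : ℝ) + 1)) with hcdef
  have hc : c ^ 2 = 1 / ((d : ℝ) + 1) := Real.sq_sqrt (by positivity)
  have hn : ∀ i, s i * n i ^ 2 = s i - r := fun i => by linear_combination s i * hmn i - hm i
  have hω1 : Complex.normSq ω = 1 := by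
    rw [Complex.normSq_eq_norm_sq, hω.norm'_eq_one hd.ne', one_pow]
  have first : ∀ j, s j * s j * (c * m j * (c * m j) * (c * m j * (c * m j))) =
      r ^ 2 / ((d : ℝ) + 1) ^ 2 := fun j => by
    calc _ = (c ^ 2) ^ 2 * (s j * m j ^ 2) ^ 2 := by ring
      _ = _ := by rw [hc, hm]; field_simp
  have second : ∀ j, s j * s j * (c * m j * (c * m j) * (n j * n j)) =
      1 / ((d : ℝ) + 1) * r * (s j - r) := fun j => by
    rw [← hc, ← hn j, ← hm j]; ring
  simp only [measVec_star, Pi.star_apply, star_star]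
  rcases x with (j | j) | j <;> rcases y with (k | k) | k <;>
    simp only [corrQ_first_first, corrQ_first_second, corrQ_first_third,
      corrQ_second_first, corrQ_second_second, corrQ_second_third, corrQ_third_first,
      corrQ_third_second, corrQ_third_third] <;>
    simp only [measVec, ← hcdef]
  -- Fourier against Fourier: damping makes the weights `s i * m i ^ 2` constant.
  · have : ∀ i : Fin d, (s i : ℂ) * (star (((c * m i : ℝ) : ℂ) * ω ^ (j * i : ℕ)) *
        (((c * m i : ℝ) : ℂ) * ω ^ (k * i : ℕ))) =
        (c ^ 2 * r : ℝ) * (star (ω ^ (j * i : ℕ)) * ω ^ (k * i : ℕ)) := fun i => by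
      rw [← hm i, star_mul', Complex.star_def, Complex.conj_ofReal]; push_cast; ring
    rw [Finset.sum_congr rfl fun i _ => this i, ← Finset.mul_sum, sum_star_pow_mul_pow hω, hc]
    split_ifs
    · rw [map_mul, Complex.normSq_ofReal, Complex.normSq_natCast]; field_simp
    · simp
  -- In every other case one vector is a multiple of a standard basis vector, so the sum has a
  -- single term.
  all_goals
    simp only [Pi.single_apply, apply_ite star, star_zero, mul_ite, ite_mul, mul_zero, zero_mul,
      Finset.sum_ite_eq', Finset.mem_univ, if_true, map_mul, map_pow, Complex.star_def,
      Complex.conj_ofReal, Complex.normSq_ofReal, Complex.normSq_conj, hω1, one_pow, mul_one]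
  all_goals try rw [apply_ite Complex.normSq, map_zero]
  all_goals try simp only [eq_comm (a := k) (b := j)]
  all_goals try
    refine if_congr_of_imp fun h => ?_
    subst h
    simp only [map_mul, Complex.normSq_ofReal]
  · rw [first k]; field_simp
  · exact second k
  · rw [first j]; field_simp
  · refine (Eq.trans (by ring) (first j)).trans ?_
    field_simp
  · rw [← second j]
  · rw [← second j]; ring
  · rw [← second j]; ring
  · rw [← hn j]
    have hr' : d * (d + 1) ^ 2 / (d * r ^ 2) * (1 / ((d : ℝ) + 1) * r * (s j * n j ^ 2)) ^ 2 =
      (s j * n j ^ 2) ^ 2 := by field_simp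
    rw [hr']; ring

/-- A state with Schmidt coefficients `s i ≥ r` generates `Q`. -/
theorem exists_povm_correlation_eq {d : ℕ} (hd : 0 < d) {s : Fin d → ℝ} {r : ℝ} (hr : 0 < r)
    (hs : ∀ i, r ≤ s i) {ρ : Matrix (Fin d × Fin d) (Fin d × Fin d) ℂ}
    (hρ : IsPureWithSchmidtCoefficients ρ s) :
    ∃ A B : Outcome d → Matrix (Fin d) (Fin d) ℂ, IsPOVM A ∧ IsPOVM B ∧
      correlation ρ A B =
        corrQ d (d * r ^ 2) (fun i => 1 / ((d : ℝ) + 1) * r * (s i - r)) := by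
  obtain ⟨α, β, hα, hβ, rfl⟩ := hρ
  have hω := Complex.isPrimitiveRoot_exp d hd.ne'
  set ω := Complex.exp (2 * Real.pi * Complex.I / d)
  have hω' : IsPrimitiveRoot (star ω) d := by
    have := hω.map_of_injective (f := starRingEnd ℂ) (RingHom.injective _)
    exact this
  have hs0 : ∀ i, 0 < s i := fun i => hr.trans_le (hs i)
  set m : Fin d → ℝ := fun i => √(r / s i)
  set n : Fin d → ℝ := fun i => √(1 - r / s i)
  have hm2 : ∀ i, m i ^ 2 = r / s i := fun i => Real.sq_sqrt (div_nonneg hr.le (hs0 i).le)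
  have hn2 : ∀ i, n i ^ 2 = 1 - r / s i := fun i =>
    Real.sq_sqrt (sub_nonneg.2 ((div_le_one (hs0 i)).2 (hs i)))
  have hmn : ∀ i, m i ^ 2 + n i ^ 2 = 1 := fun i => by rw [hm2, hn2]; ring
  have hm : ∀ i, s i * m i ^ 2 = r := fun i => by
    rw [hm2]; exact mul_div_cancel₀ r (hs0 i).ne'
  refine ⟨_, _, isPOVM_ketBra (conjTranspose_mul_of_orthonormal hα) _ (sum_ketBra_measVec hω hmn),
    isPOVM_ketBra (conjTranspose_mul_of_orthonormal hβ) _ (sum_ketBra_measVec hω' hmn), ?_⟩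
  ext x y
  rw [← normSq_sum_measVec hω hd hr hm hmn]
  exact correlation_schmidt_ketBra s hα hβ _ _ x y

/-! ### Traces against positive semidefinite matrices -/

theorem exists_eq_conjTranspose_mul_self {n : Type*} [Fintype n] {A : Matrix n n ℂ}
    (hA : A.PosSemidef) : ∃ C : Matrix n n ℂ, A = Cᴴ * C := by
  classical
  open scoped MatrixOrder in
  exact CStarAlgebra.nonneg_iff_eq_star_mul_self.1 (nonneg_iff_posSemidef.2 hA)

theorem trace_mul_nonneg {n : Type*} [Fintype n] {A B : Matrix n n ℂ} (hA : A.PosSemidef)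
    (hB : B.PosSemidef) : 0 ≤ (A * B).trace := by
  obtain ⟨C, rfl⟩ := exists_eq_conjTranspose_mul_self hB
  rw [← mul_assoc, trace_mul_comm, ← mul_assoc]
  exact (hA.mul_mul_conjTranspose_same C).trace_nonneg

/-- For `A = Dᴴ D` and `B = Cᴴ C` the trace is the squared Hilbert–Schmidt norm of `D Cᴴ`. -/
theorem mul_eq_zero_of_trace {n : Type*} [Fintype n] {A B : Matrix n n ℂ} (hA : A.PosSemidef)
    (hB : B.PosSemidef) (h : (A * B).trace = 0) : A * B = 0 := by
  obtain ⟨C, rfl⟩ := exists_eq_conjTranspose_mul_self hB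
  obtain ⟨D, rfl⟩ := exists_eq_conjTranspose_mul_self hA
  have h' : ((D * Cᴴ)ᴴ * (D * Cᴴ)).trace = 0 := by
    rw [← h, conjTranspose_mul, conjTranspose_conjTranspose, ← mul_assoc (Dᴴ * D) Cᴴ C,
      trace_mul_comm (Dᴴ * D * Cᴴ) C]
    simp only [mul_assoc]
  have h0 := trace_conjTranspose_mul_self_eq_zero_iff.1 h'
  calc Dᴴ * D * (Cᴴ * C) = Dᴴ * (D * Cᴴ) * C := by simp only [mul_assoc]
    _ = 0 := by rw [h0]; simp

theorem mulVec_eq_zero_of_dotProduct {n : Type*} [Fintype n] {A : Matrix n n ℂ}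
    (hA : A.PosSemidef) {x : n → ℂ} (h : star x ⬝ᵥ (A *ᵥ x) = 0) : A *ᵥ x = 0 :=
  (hA.dotProduct_mulVec_zero_iff x).1 h

/-- The operator `tr₂ (ρ (1 ⊗ B))` on the first factor. -/
def partialContraction {m n : Type*} [Fintype n] (ρ : Matrix (m × n) (m × n) ℂ)
    (B : Matrix n n ℂ) : Matrix m m ℂ :=
  Matrix.of fun p q => ∑ r, ∑ s, ρ (p, r) (q, s) * B s r

theorem trace_partialContraction_mul {m n : Type*} [Fintype m] [Fintype n]
    (ρ : Matrix (m × n) (m × n) ℂ) (A : Matrix m m ℂ) (B : Matrix n n ℂ) :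
    (partialContraction ρ B * A).trace = (ρ * (A ⊗ₖ B)).trace := by
  simp only [partialContraction, trace, diag_apply, mul_apply, of_apply, kroneckerMap_apply,
    Fintype.sum_prod_type, Finset.sum_mul]
  refine Finset.sum_congr rfl fun p _ => ?_
  rw [Finset.sum_comm]
  refine Finset.sum_congr rfl fun q _ => Finset.sum_congr rfl fun r _ =>
    Finset.sum_congr rfl fun s _ => by ring

/-- The quadratic form at `x` is `tr (ρ (|x⟩⟨x| ⊗ B))`. -/
theorem posSemidef_partialContraction {m n : Type*} [Fintype m] [Fintype n]
    {ρ : Matrix (m × n) (m × n) ℂ} (hρ : ρ.PosSemidef) {B : Matrix n n ℂ} (hB : B.PosSemidef) :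
    (partialContraction ρ B).PosSemidef := by
  refine .of_dotProduct_mulVec_nonneg ?_ fun x => ?_
  · ext p q
    simp only [partialContraction, conjTranspose_apply, of_apply, star_sum, star_mul']
    rw [Finset.sum_comm]
    refine Finset.sum_congr rfl fun r _ => Finset.sum_congr rfl fun s _ => ?_
    rw [hρ.1.apply, hB.1.apply]
  · rw [← trace_mul_ketBra, trace_partialContraction_mul]
    exact trace_mul_nonneg hρ ((posSemidef_ketBra x).kronecker hB)

theorem ofReal_correlation {ι κ m n : Type*} [Fintype m] [Fintype n]
    {ρ : Matrix (m × n) (m × n) ℂ} (hρ : ρ.PosSemidef) {A : ι → Matrix m m ℂ}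
    {B : κ → Matrix n n ℂ} (hA : ∀ x, (A x).PosSemidef) (hB : ∀ y, (B y).PosSemidef)
    (x : ι) (y : κ) : (correlation ρ A B x y : ℂ) = (ρ * (A x ⊗ₖ B y)).trace :=
  (Complex.eq_re_of_ofReal_le (trace_mul_nonneg hρ ((hA x).kronecker (hB y)))).symm

theorem isCorrelation_correlation {ι κ m n : Type*} [Fintype m] [Fintype n] [DecidableEq m]
    [DecidableEq n] [Fintype ι] [Fintype κ]
    {ρ : Matrix (m × n) (m × n) ℂ} (hρ : IsState ρ) {A : ι → Matrix m m ℂ}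
    {B : κ → Matrix n n ℂ} (hA : IsPOVM A) (hB : IsPOVM B) :
    IsCorrelation (correlation ρ A B) := by
  refine ⟨fun x y => (Complex.nonneg_iff.1
    (trace_mul_nonneg hρ.1 ((hA.1 x).kronecker (hB.1 y)))).1, ?_⟩
  have : ∑ x, ∑ y, A x ⊗ₖ B y = 1 := by
    rw [← one_kronecker_one, ← hA.2, ← hB.2]
    ext p q
    simp only [Matrix.sum_apply, kroneckerMap_apply, Finset.sum_mul_sum]
  have h2 : ∑ x, ∑ y, (ρ * (A x ⊗ₖ B y)).trace = 1 := by
    simp only [← trace_sum, ← Finset.mul_sum, this, mul_one, hρ.2]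
  simpa only [Complex.re_sum, Complex.one_re, correlation, of_apply] using congrArg Complex.re h2

theorem trace_swap {m n : Type*} [Fintype m] [Fintype n]
    (ρ : Matrix (m × n) (m × n) ℂ) (A : Matrix m m ℂ) (B : Matrix n n ℂ) :
    (ρ.submatrix Prod.swap Prod.swap * (B ⊗ₖ A)).trace = (ρ * (A ⊗ₖ B)).trace := by
  simp only [trace, diag_apply, mul_apply]
  refine (Fintype.sum_equiv (Equiv.prodComm _ _) _ _ fun p => ?_)
  refine (Fintype.sum_equiv (Equiv.prodComm _ _) _ _ fun q => ?_)
  simp [kroneckerMap_apply, mul_comm]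

/-! ### Rank-one structure from the zero pattern -/

theorem ketBra_smul {n : Type*} (c : ℂ) (u : n → ℂ) : ketBra (c • u) = (c * star c) • ketBra u := by
  ext p q
  simp only [ketBra, vecMulVec_apply, Pi.smul_apply, Pi.star_apply, smul_eq_mul, star_mul',
    Matrix.smul_apply]
  ring

/-- In dimension `d`, if `d` positive semidefinite operators `A i` are matched with `S j` so that
`tr (S j A i)` vanishes exactly off the diagonal, then the `A i` are the rank-one projectors onto
a basis (up to scaling), and `A i` is determined up to scaling by its zeros. -/
theorem exists_isUnit_eq_ketBra {n : Type*} [Fintype n] [DecidableEq n] {A S : n → Matrix n n ℂ}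
    (hA : ∀ i, (A i).PosSemidef) (hS : ∀ i, (S i).PosSemidef)
    (h : ∀ i j, (S j * A i).trace = 0 ↔ i ≠ j) :
    ∃ U : Matrix n n ℂ, IsUnit U ∧ (∀ i, A i = ketBra (U *ᵥ Pi.single i 1)) ∧
      ∀ i X, X.PosSemidef → (∀ j, i ≠ j → (S j * X).trace = 0) → ∃ c : ℂ, X = c • A i := by
  have hz : ∀ i X, X.PosSemidef → (∀ j, i ≠ j → (S j * X).trace = 0) → ∀ j, i ≠ j → X * S j = 0 :=
    fun i X hX h0 j hj => mul_eq_zero_of_trace hX (hS j) (by rw [trace_mul_comm]; exact h0 j hj)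
  -- Some column of `S i` survives `A i`, whereas `A i` kills every column of `S j` for `j ≠ i`. The
  -- chosen columns form `V`.
  have hne : ∀ i, ∃ q, A i *ᵥ (fun p => S i p q) ≠ 0 := fun i => by
    by_contra! hq
    refine (h i i).1.mt (by simp) ?_
    rw [trace_mul_comm]
    have : A i * S i = 0 := by
      ext p q
      exact congrFun (hq q) p
    rw [this, trace_zero]
  choose q hq using hne
  set V : Matrix n n ℂ := Matrix.of fun p i => S i p (q i) with hVdef
  have hkill : ∀ i X, X.PosSemidef → (∀ j, i ≠ j → (S j * X).trace = 0) →
      ∀ p j, i ≠ j → (X * V) p j = 0 := fun i X hX h0 p j hj =>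
    congrFun (congrFun (hz i X hX h0 j hj) p) (q j)
  have hAkill : ∀ i p j, i ≠ j → (A i * V) p j = 0 := fun i =>
    hkill i (A i) (hA i) fun j hj => (h i j).2 hj
  have hVunit : IsUnit V := by
    -- Applying `A i` to a vanishing combination of the columns isolates the `i`-th coefficient.
    rw [← mulVec_injective_iff_isUnit, ← coe_mulVecLin, injective_iff_map_eq_zero]
    intro w hw
    rw [mulVecLin_apply] at hw
    ext i
    by_contra hwi
    refine hq i ?_
    ext p
    have h1 : ((A i * V) *ᵥ w) p = 0 := by rw [← mulVec_mulVec, hw, mulVec_zero]; rfl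
    rw [mulVec, dotProduct, Finset.sum_eq_single i
      (fun j _ hj => by rw [hAkill i p j hj.symm, zero_mul]) (by simp)] at h1
    exact (mul_eq_zero.1 h1).resolve_right hwi
  obtain ⟨V', hVV'⟩ : ∃ V', V * V' = 1 :=
    ⟨V⁻¹, mul_nonsing_inv _ ((isUnit_iff_isUnit_det _).1 hVunit)⟩
  -- `Vᴴ X V` has only its `(i, i)` entry, so undoing the congruence shows that `X` is a multiple of
  -- one fixed rank-one matrix.
  have hform : ∀ i X, X.PosSemidef → (∀ j, i ≠ j → (S j * X).trace = 0) →
      ∃ t : ℝ, 0 ≤ t ∧ X = (t : ℂ) • ketBra (V'ᴴ *ᵥ Pi.single i 1) := fun i X hX h0 => by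
    have hM := hX.conjTranspose_mul_mul_same V
    set M := Vᴴ * X * V with hMdef
    have hM0 : ∀ k l, i ≠ l → M k l = 0 := fun k l hl => by
      rw [hMdef, mul_assoc, mul_apply]
      exact Finset.sum_eq_zero fun p _ => by rw [hkill i X hX h0 p l hl, mul_zero]
    have hM0' : ∀ k l, i ≠ k → M k l = 0 := fun k l hk => by
      rw [← hM.1.apply, hM0 l k hk, star_zero]
    have hre := Complex.nonneg_iff.1 (hM.diag_nonneg (i := i))
    obtain ⟨t, ht0, ht⟩ : ∃ t : ℝ, 0 ≤ t ∧ M i i = t :=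
      ⟨_, hre.1, Complex.ext rfl (by simpa using hre.2.symm)⟩
    refine ⟨t, ht0, ?_⟩
    have hMeq : M = (t : ℂ) • ketBra (Pi.single i 1) := by
      ext k l
      simp only [Matrix.smul_apply, ketBra, vecMulVec_apply, Pi.star_apply, Pi.single_apply]
      by_cases hk : i = k
      · by_cases hl : i = l
        · subst hk; subst hl
          simp [ht]
        · rw [hM0 k l hl]; simp [Ne.symm hl]
      · rw [hM0' k l hk]; simp [Ne.symm hk]
    calc X = (V * V')ᴴ * X * (V * V') := by rw [hVV']; simp
      _ = V'ᴴ * M * V' := by rw [hMdef, conjTranspose_mul]; simp only [mul_assoc]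
      _ = _ := by
        rw [hMeq, mul_smul_comm, smul_mul_assoc, ← mul_ketBra_mul_conjTranspose,
          conjTranspose_conjTranspose]
  choose t ht0 ht using fun i => hform i (A i) (hA i) fun j hj => (h i j).2 hj
  have htpos : ∀ i, 0 < t i := fun i => (ht0 i).lt_of_ne' fun h0 => by
    refine (h i i).1.mt (by simp) ?_
    rw [ht i, h0]; simp
  have hsq : ∀ i, (√(t i) : ℂ) * star (√(t i) : ℂ) = t i := fun i => by
    rw [Complex.star_def, Complex.conj_ofReal, ← Complex.ofReal_mul, Real.mul_self_sqrt (ht0 i)]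
  refine ⟨V'ᴴ * diagonal fun i => (√(t i) : ℂ), ?_, fun i => ?_, fun i X hX h0 => ?_⟩
  · refine IsUnit.mul ?_ ?_
    · exact IsUnit.of_mul_eq_one Vᴴ (by rw [← conjTranspose_mul, hVV', conjTranspose_one])
    · rw [isUnit_diagonal, Pi.isUnit_iff]
      exact fun i => isUnit_iff_ne_zero.2 (by simpa using (Real.sqrt_pos.2 (htpos i)).ne')
  · have : (diagonal fun i => (√(t i) : ℂ)) *ᵥ Pi.single i 1 = (√(t i) : ℂ) • Pi.single i 1 := by
      ext k
      rw [mulVec_diagonal]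
      by_cases hk : k = i
      · subst hk; simp
      · simp [hk]
    rw [← mulVec_mulVec, this, mulVec_smul, ketBra_smul, hsq, ← ht]
  · obtain ⟨c, -, hc⟩ := hform i X hX h0
    refine ⟨c / t i, ?_⟩
    rw [ht i, smul_smul, div_mul_cancel₀ _ (by exact_mod_cast (htpos i).ne'), ← hc]

/-! ### The state in the bases found -/

/-- A positive semidefinite matrix with constant diagonal `κ` attaining the largest possible value
of its quadratic form at a vector of phases is rank one. -/
theorem apply_eq_of_dotProduct_mulVec_eq {n : Type*} [Fintype n] [DecidableEq n]
    {T : Matrix n n ℂ} (hT : T.PosSemidef) {κ : ℝ} (hdiag : ∀ i, T i i = κ) {x : n → ℂ}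
    (hx : ∀ i, x i * star (x i) = 1)
    (hmax : star x ⬝ᵥ (T *ᵥ x) = (Fintype.card n : ℂ) ^ 2 * κ) (i j : n) :
    T i j = κ * (x i * star (x j)) := by
  have hx' : ∀ i, star (x i) * x i = 1 := fun i => by rw [mul_comm, hx]
  -- The forms of `T` at the vectors `x i e_i - x j e_j` are nonnegative and sum to `2 (card n)² κ -
  -- 2 x* T x = 0`, so `T` kills each of these vectors.
  set w : n → n → n → ℂ := fun i j => Pi.single i (x i) - Pi.single j (x j) with hw
  have hTw : ∀ i j k, (T *ᵥ w i j) k = T k i * x i - T k j * x j := fun i j k => by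
    simp [hw, mulVec_sub, mul_comm]
  have hquad : ∀ i j, star (w i j) ⬝ᵥ (T *ᵥ w i j) =
      2 * κ - star (x i) * T i j * x j - star (x j) * T j i * x i := fun i j => by
    have : star (w i j) = Pi.single i (star (x i)) - Pi.single j (star (x j)) := by
      rw [hw]; simp only [star_sub, Pi.single_star]
    rw [this, sub_dotProduct, single_dotProduct, single_dotProduct, hTw, hTw, hdiag, hdiag]
    linear_combination (κ : ℂ) * hx' i + κ * hx' j
  have hexp : star x ⬝ᵥ (T *ᵥ x) = ∑ i, ∑ j, star (x i) * T i j * x j := by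
    simp only [dotProduct, mulVec, Finset.mul_sum, Pi.star_apply, mul_assoc]
  have hexp' : star x ⬝ᵥ (T *ᵥ x) = ∑ i, ∑ j, star (x j) * T j i * x i := by
    rw [hexp, Finset.sum_comm]
  have hsum : ∑ p : n × n, star (w p.1 p.2) ⬝ᵥ (T *ᵥ w p.1 p.2) = 0 := by
    simp only [hquad, Fintype.sum_prod_type, Finset.sum_sub_distrib, ← hexp, ← hexp', hmax]
    simp only [Finset.sum_const, Finset.card_univ, nsmul_eq_mul]
    ring
  have h0 := (Finset.sum_eq_zero_iff_of_nonneg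
    fun p _ => hT.dotProduct_mulVec_nonneg (w p.1 p.2)).1 hsum
  have h1 := congrFun (mulVec_eq_zero_of_dotProduct hT (h0 (j, i) (Finset.mem_univ _))) i
  rw [hTw, hdiag, Pi.zero_apply] at h1
  linear_combination star (x j) * h1 - T i j * hx j

/-- The vector `∑ i, y i • (e i ⊗ e i)`. -/
def diagVec {n : Type*} [DecidableEq n] (y : n → ℂ) : n × n → ℂ :=
  fun p => if p.1 = p.2 then y p.1 else 0

/-- A zero diagonal entry of a positive semidefinite matrix kills its row and column, so only the
coordinates `(i, i)` matter. -/
theorem dotProduct_mulVec_of_diag {n : Type*} [Fintype n] [DecidableEq n]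
    {R : Matrix (n × n) (n × n) ℂ} (hR : R.PosSemidef) (h0 : ∀ i k, i ≠ k → R (i, k) (i, k) = 0) :
    (∀ p q, p.1 ≠ p.2 → R p q = 0) ∧ (∀ p q, q.1 ≠ q.2 → R p q = 0) ∧
    ∀ w, star w ⬝ᵥ (R *ᵥ w) = star (fun i => w (i, i)) ⬝ᵥ
      ((R.submatrix (fun i => (i, i)) fun i => (i, i)) *ᵥ fun i => w (i, i)) := by
  have hcol : ∀ p q, q.1 ≠ q.2 → R p q = 0 := fun p q hq => by
    have := mulVec_eq_zero_of_dotProduct hR (x := Pi.single q 1) (by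
      rw [mulVec_single_one, ← Pi.single_star, single_dotProduct, col_apply,
        h0 q.1 q.2 hq, mul_zero])
    rw [mulVec_single_one] at this
    exact congrFun this p
  have hrow : ∀ p q, p.1 ≠ p.2 → R p q = 0 := fun p q hp => by
    rw [← hR.1.apply, hcol q p hp, star_zero]
  refine ⟨hrow, hcol, fun w => ?_⟩
  simp only [dotProduct, mulVec, Fintype.sum_prod_type, submatrix_apply, Pi.star_apply]
  refine Finset.sum_congr rfl fun i _ => ?_
  rw [Finset.sum_eq_single i]
  · congr 1
    refine Finset.sum_congr rfl fun j _ => ?_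
    rw [Finset.sum_eq_single j (fun k _ hk => by rw [hcol _ (j, k) hk.symm, zero_mul]) (by simp)]
  · intro k _ hk
    rw [Finset.sum_eq_zero, mul_zero]
    intro j _
    exact Finset.sum_eq_zero fun l _ => by rw [hrow (i, k) _ hk.symm, zero_mul]
  · simp

/-- On the diagonal only `θ i` survives, so first-against-second statistics read off `|θ i|`. -/
theorem tensorVec_diag_single {n : Type*} [DecidableEq n] (θ : n → ℂ) (i : n) :
    (fun l => tensorVec θ (Pi.single i 1) (l, l)) = Pi.single i (θ i) := by
  ext l
  by_cases h : l = i
  · subst h; simp [tensorVec]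
  · simp [tensorVec, h]

theorem tensorVec_single_diag {n : Type*} [DecidableEq n] (φ : n → ℂ) (i : n) :
    (fun l => tensorVec (Pi.single i 1) φ (l, l)) = Pi.single i (φ i) := by
  ext l
  by_cases h : l = i
  · subst h; simp [tensorVec]
  · simp [tensorVec, h]

/-- The statistics of the first two groups of outcomes, in the bases given by the second group,
determine the state and force the first group to come from a pair of Hadamard matrices. -/
theorem exists_eq_ketBra_diagVec {n : Type*} [Fintype n] [DecidableEq n] [Nonempty n]
    {R : Matrix (n × n) (n × n) ℂ} (hR : R.PosSemidef) {κ : ℝ} (hκ : κ ≠ 0)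
    (hdiag : ∀ i k, R (i, k) (i, k) = if i = k then (κ : ℂ) else 0) {θ φ : n → n → ℂ}
    (hθ : ∀ j i, star (tensorVec (θ j) (Pi.single i 1)) ⬝ᵥ
      (R *ᵥ tensorVec (θ j) (Pi.single i 1)) = κ)
    (hφ : ∀ i j, star (tensorVec (Pi.single i 1) (φ j)) ⬝ᵥ
      (R *ᵥ tensorVec (Pi.single i 1) (φ j)) = κ)
    (hθφ : ∀ j k, star (tensorVec (θ j) (φ k)) ⬝ᵥ (R *ᵥ tensorVec (θ j) (φ k)) =
      if j = k then (Fintype.card n : ℂ) ^ 2 * κ else 0) :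
    ∃ y : n → ℂ, (∀ i, y i * star (y i) = 1) ∧ R = (κ : ℂ) • ketBra (diagVec y) ∧
      ∑ j, ketBra (θ j) = (Fintype.card n : ℂ) • 1 ∧
      ∑ j, ketBra (φ j) = (Fintype.card n : ℂ) • 1 := by
  have hκ' : (κ : ℂ) ≠ 0 := by exact_mod_cast hκ
  obtain ⟨hrow, hcol, hquad⟩ := dotProduct_mulVec_of_diag hR
    fun i k h => by rw [hdiag, if_neg h]
  set T := R.submatrix (fun i => (i, i)) fun i => (i, i) with hTdef
  have hT : T.PosSemidef := hR.submatrix _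
  have hTdiag : ∀ i, T i i = κ := fun i => by rw [hTdef, submatrix_apply, hdiag, if_pos rfl]
  have hsingle : ∀ (i : n) (c : ℂ), star (Pi.single i c : n → ℂ) ⬝ᵥ (T *ᵥ Pi.single i c) = κ →
      c * star c = 1 := fun i c h => by
    rw [← Pi.single_star, single_dotProduct, mulVec_single] at h
    simp only [Pi.smul_apply, col_apply, hTdiag, MulOpposite.smul_eq_mul_unop,
      MulOpposite.unop_op] at h
    exact mul_left_cancel₀ hκ' (by linear_combination h)
  have hθ1 : ∀ j i, θ j i * star (θ j i) = 1 := fun j i => hsingle i _ (by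
    rw [← tensorVec_diag_single, ← hquad, hθ])
  have hφ1 : ∀ j i, φ j i * star (φ j i) = 1 := fun j i => hsingle i _ (by
    rw [← tensorVec_single_diag, ← hquad, hφ])
  set x : n → n → ℂ := fun j i => θ j i * φ j i with hxdef
  have hx1 : ∀ j i, x j i * star (x j i) = 1 := fun j i => by
    simp only [hxdef, star_mul']
    linear_combination hθ1 j i * (φ j i * star (φ j i)) + hφ1 j i
  have hTx : ∀ j i k, T i k = κ * (x j i * star (x j k)) := fun j =>
    apply_eq_of_dotProduct_mulVec_eq hT hTdiag (hx1 j) (by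
      have := hθφ j j
      rwa [hquad, if_pos rfl] at this)
  obtain ⟨j₀⟩ := ‹Nonempty n›
  set y := x j₀ with hy
  have hy1 : ∀ i, y i * star (y i) = 1 := hx1 j₀
  -- All the `x j` factor the same rank-one `T`, hence differ from `y` only by the global phases `g
  -- j`.
  set g : n → ℂ := fun j => x j j₀ * star (y j₀) with hg
  have hg1 : ∀ j, g j * star (g j) = 1 := fun j => by
    simp only [hg, star_mul', star_star]
    linear_combination hx1 j j₀ * (star (y j₀) * y j₀) + hy1 j₀
  have hxg : ∀ j i, x j i = g j * y i := fun j i => by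
    have h1 : x j i * star (x j j₀) = y i * star (y j₀) :=
      mul_left_cancel₀ hκ' ((hTx j i j₀).symm.trans (hTx j₀ i j₀))
    simp only [hg]
    linear_combination x j j₀ * h1 - x j i * hx1 j j₀
  have hφθ : ∀ j i, φ j i = g j * y i * star (θ j i) := fun j i => by
    rw [← hxg]
    simp only [hxdef]
    linear_combination -φ j i * hθ1 j i
  -- The form at `θ j ⊗ φ k` is `κ` times a squared overlap with `y`. Substituting `φ k = g k * y *
  -- star (θ k)` turns that overlap into the inner product of `θ j` and `θ k`, up to a phase.
  have horth : ∀ j k, j ≠ k → ∑ i, θ j i * star (θ k i) = 0 := fun j k hjk => by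
    have h1 := hθφ j k
    have h2 : star (fun i => tensorVec (θ j) (φ k) (i, i)) ⬝ᵥ
        (T *ᵥ fun i => tensorVec (θ j) (φ k) (i, i)) =
        κ * (star (∑ i, star (y i) * (θ j i * φ k i)) * ∑ i, star (y i) * (θ j i * φ k i)) := by
      rw [star_sum, Finset.sum_mul_sum]
      simp only [dotProduct, mulVec, Pi.star_apply, tensorVec, Finset.mul_sum]
      refine Finset.sum_congr rfl fun i _ => Finset.sum_congr rfl fun l _ => ?_
      rw [hTx j₀]
      simp only [star_mul', star_star]
      ring
    rw [hquad, h2, if_neg hjk] at h1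
    have h3 := (mul_eq_zero.1 h1).resolve_left hκ'
    have h4 : ∑ i, star (y i) * (θ j i * φ k i) = 0 := by
      rcases mul_eq_zero.1 h3 with h | h
      · exact star_eq_zero.1 h
      · exact h
    have h5 : ∑ i, star (y i) * (θ j i * φ k i) = g k * ∑ i, θ j i * star (θ k i) := by
      rw [Finset.mul_sum]
      refine Finset.sum_congr rfl fun i _ => ?_
      rw [hφθ]
      linear_combination (θ j i * g k * star (θ k i)) * hy1 i
    rw [h5] at h4
    refine (mul_eq_zero.1 h4).resolve_left fun h => ?_
    have := hg1 k
    rw [h, zero_mul] at this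
    exact zero_ne_one this
  have hΘ : (Matrix.of θ) * (Matrix.of θ)ᴴ = (Fintype.card n : ℂ) • 1 := by
    ext j k
    rw [mul_apply, Matrix.smul_apply, one_apply]
    simp only [of_apply, conjTranspose_apply]
    by_cases hjk : j = k
    · subst hjk; simp only [hθ1]; simp
    · rw [horth j k hjk, if_neg hjk, smul_zero]
  have hN : (Fintype.card n : ℂ) ≠ 0 := by
    have : 0 < Fintype.card n := Fintype.card_pos_iff.2 ⟨j₀⟩
    exact_mod_cast this.ne'
  -- Row orthogonality of a square matrix gives column orthogonality, which is what summing the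
  -- projectors requires.
  have hΘ' : (Matrix.of θ)ᴴ * (Matrix.of θ) = (Fintype.card n : ℂ) • 1 := by
    have h1 : (Matrix.of θ) * ((Fintype.card n : ℂ)⁻¹ • (Matrix.of θ)ᴴ) = 1 := by
      rw [mul_smul_comm, hΘ, smul_smul, inv_mul_cancel₀ hN, one_smul]
    have h2 := mul_eq_one_comm.1 h1
    rw [smul_mul_assoc] at h2
    rw [← h2, smul_smul, mul_inv_cancel₀ hN, one_smul]
  have hcols : ∀ i k, ∑ j, star (θ j i) * θ j k = if i = k then (Fintype.card n : ℂ) else 0 :=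
    fun i k => by
      have := congrFun (congrFun hΘ' i) k
      rw [mul_apply, Matrix.smul_apply, one_apply] at this
      simpa using this
  refine ⟨y, hy1, ?_, ?_, ?_⟩
  · ext p q
    simp only [Matrix.smul_apply, ketBra, vecMulVec_apply, Pi.star_apply, diagVec]
    rcases p with ⟨i, i'⟩
    rcases q with ⟨k, k'⟩
    by_cases hp : i = i'
    · by_cases hq : k = k'
      · subst hp; subst hq
        simp only [if_true, smul_eq_mul]
        exact hTx j₀ i k
      · rw [hcol _ _ hq]; simp [hq]
    · rw [hrow _ _ hp]; simp [hp]
  · ext i k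
    rw [Matrix.sum_apply, Matrix.smul_apply, one_apply]
    simp only [ketBra, vecMulVec_apply, Pi.star_apply, mul_comm (θ _ i), hcols]
    by_cases h : i = k
    · simp [h]
    · simp [h, Ne.symm h]
  · ext i k
    rw [Matrix.sum_apply, Matrix.smul_apply, one_apply]
    have : ∀ j, ketBra (φ j) i k = y i * star (y k) * (star (θ j i) * θ j k) := fun j => by
      rw [ketBra, vecMulVec_apply, Pi.star_apply, hφθ, hφθ]
      simp only [star_mul', star_star]
      linear_combination (y i * star (θ j i) * star (y k) * θ j k) * hg1 j
    rw [Finset.sum_congr rfl fun j _ => this j, ← Finset.mul_sum, hcols]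
    by_cases h : i = k
    · subst h; rw [hy1, if_pos rfl, if_pos rfl, smul_eq_mul, mul_comm]
    · simp [h]

/-! ### States generating `Q` -/

/-- In a realization of `Q`, the second group of operators is the family of rank-one projectors on
a basis (up to scaling), the third group is proportional to it, and the first group has rank one. -/
theorem exists_basis_of_trace_eq_corrQ {d : ℕ} {a : ℝ} {z : Fin d → ℝ}
    (hd : 0 < d) (ha : 0 < a)
    {ρ : Matrix (Fin d × Fin d) (Fin d × Fin d) ℂ} (hρ : ρ.PosSemidef)
    {A B : Outcome d → Matrix (Fin d) (Fin d) ℂ} (hA : ∀ x, (A x).PosSemidef)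
    (hB : ∀ x, (B x).PosSemidef)
    (h : ∀ x y, (ρ * (A x ⊗ₖ B y)).trace = corrQ d a z x y) :
    ∃ (U : Matrix (Fin d) (Fin d) ℂ) (θ : Fin d → Fin d → ℂ), IsUnit U ∧
      (∀ j, A (.inl (.inl j)) = ketBra (U *ᵥ θ j)) ∧
      (∀ i, A (.inl (.inr i)) = ketBra (U *ᵥ Pi.single i 1)) ∧
      ∀ i, A (.inr i) = ((z i / (a / (d * (d + 1) ^ 2)) : ℝ) : ℂ) • ketBra (U *ᵥ Pi.single i 1) := by
  have hd' : (0 : ℝ) < d := by exact_mod_cast hd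
  have hκ : 0 < a / ((d : ℝ) * (d + 1) ^ 2) := by positivity
  have hS : ∀ y, (partialContraction ρ (B y)).PosSemidef :=
    fun y => posSemidef_partialContraction hρ (hB y)
  have htr : ∀ x y, (partialContraction ρ (B y) * A x).trace = corrQ d a z x y := fun x y => by
    rw [trace_partialContraction_mul, h]
  obtain ⟨F, -, hF, -⟩ := exists_isUnit_eq_ketBra (A := fun i => A (.inl (.inl i)))
    (S := fun i => partialContraction ρ (B (.inl (.inl i)))) (fun i => hA _) (fun i => hS _)
    (fun i j => by
      rw [htr, corrQ_first_first]
      have : a * (d : ℝ) ^ 2 / (d * (d + 1) ^ 2) ≠ 0 := by positivity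
      by_cases hij : i = j
      · rw [if_pos hij, Complex.ofReal_eq_zero]; simp only [this, hij, ne_eq, not_true]
      · simp [hij])
  obtain ⟨U, hU, hUA, hUX⟩ := exists_isUnit_eq_ketBra (A := fun i => A (.inl (.inr i)))
    (S := fun i => partialContraction ρ (B (.inl (.inr i)))) (fun i => hA _) (fun i => hS _)
    (fun i j => by
      rw [htr, corrQ_second_second]
      by_cases hij : i = j
      · rw [if_pos hij, Complex.ofReal_eq_zero]; simp only [hκ.ne', hij, ne_eq, not_true]
      · simp [hij])
  refine ⟨U, fun j => U⁻¹ *ᵥ (F *ᵥ Pi.single j 1), hU, fun j => ?_, hUA, fun i => ?_⟩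
  · rw [mulVec_mulVec, mul_nonsing_inv _ ((isUnit_iff_isUnit_det _).1 hU), one_mulVec]
    exact hF j
  -- The third group shares the zeros of the second, hence is proportional to it; one nonzero entry
  -- of `Q` fixes the factor.
  · obtain ⟨c, hc⟩ := hUX i (A (.inr i)) (hA _) fun j hij => by
      rw [htr, corrQ_third_second, if_neg hij, Complex.ofReal_zero]
    have h1 := h (.inr i) (.inl (.inr i))
    rw [hc, smul_kronecker, mul_smul_comm, trace_smul, h, corrQ_second_second, if_pos rfl,
      corrQ_third_second, if_pos rfl, smul_eq_mul] at h1
    have hκ' : ((a / ((d : ℝ) * (d + 1) ^ 2) : ℝ) : ℂ) ≠ 0 := by exact_mod_cast hκ.ne'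
    rw [← hUA, hc, Complex.ofReal_div, ← h1, mul_div_cancel_right₀ _ hκ']

/-- Completeness of the measurement, once the first group is known to sum to a multiple of the sum
of the second. -/
theorem mul_diagonal_mul_conjTranspose_eq_one {d : ℕ} {A : Outcome d → Matrix (Fin d) (Fin d) ℂ}
    (hA : ∑ x, A x = 1) {U : Matrix (Fin d) (Fin d) ℂ} {θ : Fin d → Fin d → ℂ} {c : Fin d → ℝ}
    (h1 : ∀ j, A (.inl (.inl j)) = ketBra (U *ᵥ θ j))
    (h2 : ∀ i, A (.inl (.inr i)) = ketBra (U *ᵥ Pi.single i 1))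
    (h3 : ∀ i, A (.inr i) = (c i : ℂ) • ketBra (U *ᵥ Pi.single i 1))
    (hθ : ∑ j, ketBra (θ j) = (d : ℂ) • (1 : Matrix (Fin d) (Fin d) ℂ)) :
    U * diagonal (fun i => ((d + 1 + c i : ℝ) : ℂ)) * Uᴴ = 1 := by
  have h3' : ∀ i, A (.inr i) = U * ((c i : ℂ) • ketBra (Pi.single i 1)) * Uᴴ := fun i => by
    rw [h3, ← mul_ketBra_mul_conjTranspose, mul_smul_comm, smul_mul_assoc]
  rw [← hA, Fintype.sum_sum_type, Fintype.sum_sum_type]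
  simp only [h1, h2, h3', ← mul_ketBra_mul_conjTranspose, ← Finset.sum_mul, ← Finset.mul_sum,
    ← add_mul, ← mul_add, hθ]
  congr 2
  ext k l
  simp only [diagonal_apply, Matrix.add_apply, Matrix.sum_apply, Matrix.smul_apply, one_apply,
    ketBra, vecMulVec_apply, Pi.star_apply, Pi.single_apply, apply_ite star, star_one, star_zero,
    smul_eq_mul, mul_ite, mul_zero, mul_one, Finset.sum_ite_eq,
    Finset.mem_univ, if_true]
  by_cases hkl : k = l
  · subst hkl; simp
  · simp [hkl]

/-- A state generating `Q` is pure, with Schmidt coefficients `s`. -/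
theorem isPureWithSchmidtCoefficients_of_trace_eq_corrQ {d : ℕ} (hd : 0 < d) {s : Fin d → ℝ}
    {r : ℝ} (hr : 0 < r) (hs : ∀ i, r < s i)
    {ρ : Matrix (Fin d × Fin d) (Fin d × Fin d) ℂ} (hρ : ρ.PosSemidef)
    {A B : Outcome d → Matrix (Fin d) (Fin d) ℂ} (hA : IsPOVM A) (hB : IsPOVM B)
    (h : ∀ x y, (ρ * (A x ⊗ₖ B y)).trace =
      corrQ d (d * r ^ 2) (fun i => 1 / ((d : ℝ) + 1) * r * (s i - r)) x y) :
    IsPureWithSchmidtCoefficients ρ s := by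
  have hd' : (0 : ℝ) < d := by exact_mod_cast hd
  set z : Fin d → ℝ := fun i => 1 / ((d : ℝ) + 1) * r * (s i - r) with hzdef
  have hz : ∀ i, 0 < z i := fun i => by
    have := sub_pos.2 (hs i)
    positivity
  have ha : 0 < d * r ^ 2 := by positivity
  obtain ⟨U, θ, hU, hA1, hA2, hA3⟩ := exists_basis_of_trace_eq_corrQ hd ha hρ hA.1 hB.1 h
  obtain ⟨W, φ, hW, hB1, hB2, hB3⟩ := exists_basis_of_trace_eq_corrQ hd ha
    (hρ.submatrix Prod.swap) hB.1 hA.1 (fun x y => by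
      rw [trace_swap, h, ← transpose_apply (corrQ _ _ _), corrQ_transpose])
  set κ : ℝ := d * r ^ 2 / (d * (d + 1) ^ 2) with hκdef
  have hκ : 0 < κ := by positivity
  -- `R` is the Gram-type form of `ρ` in the product basis of columns of `U` and `W`, not yet known
  -- to be orthogonal.
  set R := (U ⊗ₖ W)ᴴ * ρ * (U ⊗ₖ W) with hRdef
  have hRquad : ∀ u v, star (tensorVec u v) ⬝ᵥ (R *ᵥ tensorVec u v) =
      (ρ * (ketBra (U *ᵥ u) ⊗ₖ ketBra (W *ᵥ v))).trace := fun u v => by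
    rw [ketBra_kronecker, trace_mul_ketBra, ← kronecker_mulVec_tensorVec, star_mulVec, hRdef,
      ← mulVec_mulVec, ← mulVec_mulVec, dotProduct_mulVec]
  have hnon : Nonempty (Fin d) := ⟨⟨0, hd⟩⟩
  obtain ⟨y, hy, hR, hθ, hφ⟩ := exists_eq_ketBra_diagVec (hρ.conjTranspose_mul_mul_same (U ⊗ₖ W))
    hκ.ne' (θ := θ) (φ := φ)
    (fun i k => by
      have h1 := hRquad (Pi.single i 1) (Pi.single k 1)
      have h2 : tensorVec (Pi.single i (1 : ℂ)) (Pi.single k (1 : ℂ)) = Pi.single (i, k) 1 := by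
        ext ⟨p, q⟩
        simp only [tensorVec, Pi.single_apply, Prod.mk.injEq, ite_and, ite_mul, one_mul, zero_mul]
      rw [h2, mulVec_single_one, ← Pi.single_star, single_dotProduct, star_one, one_mul, col_apply,
        ← hA2, ← hB2, h, corrQ_second_second] at h1
      rw [← hRdef, h1]
      split_ifs <;> simp [hκdef])
    (fun j i => by rw [← hRdef, hRquad, ← hA1, ← hB2, h, corrQ_first_second])
    (fun i j => by rw [← hRdef, hRquad, ← hB1, ← hA2, h, corrQ_second_first])
    (fun j k => by
      rw [← hRdef, hRquad, ← hA1, ← hB1, h, corrQ_first_first, Fintype.card_fin]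
      split_ifs
      · rw [hκdef]; push_cast; ring
      · simp)
  rw [Fintype.card_fin] at hθ hφ
  -- The three groups contribute `d`, `1` and `z i / κ` to completeness.
  set D : Fin d → ℝ := fun i => d + 1 + z i / κ with hD
  have hDpos : ∀ i, 0 < D i := fun i => by have := hz i; positivity
  have hUD : U * diagonal (fun i => (D i : ℂ)) * Uᴴ = 1 :=
    mul_diagonal_mul_conjTranspose_eq_one hA.2 hA1 hA2 hA3 hθ
  have hWD : W * diagonal (fun i => (D i : ℂ)) * Wᴴ = 1 :=
    mul_diagonal_mul_conjTranspose_eq_one hB.2 hB1 hB2 hB3 hφ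
  -- Here `√κ = r / (d + 1)`, so the product is `r + (s i - r)`.
  have hsD : ∀ i, √κ * D i = s i := fun i => by
    have h1 : κ = (r / (d + 1)) ^ 2 := by rw [hκdef]; field_simp
    have h2 : √κ = r / (d + 1) := by rw [h1, Real.sqrt_sq (by positivity)]
    rw [h2, hD]
    simp only [h1, hzdef]
    field_simp
    ring
  have hsqD : ∀ i, (√(D i) : ℂ) * (√(D i) : ℂ) = D i := fun i => by
    rw [← Complex.ofReal_mul, Real.mul_self_sqrt (hDpos i).le]
  have hunit : ∀ (V : Matrix (Fin d) (Fin d) ℂ) (w : Fin d → ℂ), (∀ i, w i * star (w i) = 1) →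
      V * diagonal (fun i => (D i : ℂ)) * Vᴴ = 1 →
      (V * diagonal fun i => √(D i) * w i)ᴴ * (V * diagonal fun i => √(D i) * w i) = 1 :=
    fun V w hw hV => by
      rw [mul_eq_one_comm, ← hV, conjTranspose_mul, diagonal_conjTranspose, mul_assoc,
        ← mul_assoc (diagonal _), diagonal_mul_diagonal, mul_assoc]
      congr 3
      ext i
      simp only [Pi.star_apply, star_mul', Complex.star_def, Complex.conj_ofReal]
      rw [← Complex.star_def]
      linear_combination hsqD i * (w i * star (w i)) + D i * hw i
  -- Rescaling the columns by `√(D i)` makes them orthonormal; the phases `y` are absorbed into the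
  -- first family.
  refine ⟨_, _, orthonormal_of_conjTranspose_mul (hunit U y hy hUD),
    orthonormal_of_conjTranspose_mul (hunit W 1 (by simp) hWD), ?_⟩
  -- Completeness makes `X` the inverse of `(U ⊗ₖ W)ᴴ`, so `ρ` is recovered from `R`.
  set X := (U * diagonal fun i => (D i : ℂ)) ⊗ₖ (W * diagonal fun i => (D i : ℂ)) with hX
  have hXU : X * (U ⊗ₖ W)ᴴ = 1 := by
    rw [hX, conjTranspose_kronecker, ← mul_kronecker_mul, hUD, hWD, one_kronecker_one]
  have hXU' : (U ⊗ₖ W) * Xᴴ = 1 := by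
    rw [← conjTranspose_conjTranspose (U ⊗ₖ W), ← conjTranspose_mul, hXU, conjTranspose_one]
  have hρR : ρ = X * R * Xᴴ := by
    calc ρ = (X * (U ⊗ₖ W)ᴴ) * ρ * ((U ⊗ₖ W) * Xᴴ) := by rw [hXU, hXU']; simp
      _ = _ := by rw [hRdef]; simp only [mul_assoc]
  have hsqκ : (√κ : ℂ) * star (√κ : ℂ) = κ := by
    rw [Complex.star_def, Complex.conj_ofReal, ← Complex.ofReal_mul, Real.mul_self_sqrt hκ.le]
  have hvec : (√κ : ℂ) • (X *ᵥ diagVec y) = schmidtVector s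
      (fun i => WithLp.toLp 2 fun p => (U * diagonal fun i => √(D i) * y i) p i)
      (fun i => WithLp.toLp 2 fun p => (W * diagonal fun i => √(D i) * (1 : Fin d → ℂ) i) p i) := by
    ext p
    rw [Pi.smul_apply, smul_eq_mul]
    simp only [schmidtVector, mul_diagonal, mulVec, dotProduct, hX,
      kroneckerMap_apply, Fintype.sum_prod_type, diagVec, mul_ite, mul_zero, Finset.sum_ite_eq,
      Finset.mem_univ, if_true, Finset.mul_sum, Pi.one_apply, mul_one]
    refine Finset.sum_congr rfl fun i _ => ?_
    rw [← hsD i]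
    push_cast
    linear_combination -(√κ * D i * U p.1 i * W p.2 i * y i : ℂ) * hsqD i
  rw [← hvec, hρR, hRdef, hR, mul_smul_comm, smul_mul_assoc, mul_ketBra_mul_conjTranspose, ← hsqκ,
    ← ketBra_smul]
  rfl

end SemiSelfTest

/-! ### Specialization to `s i = √λ_i` and `r = √λ_d / 2`. -/

theorem theorem2 (d : ℕ) (hd : 0 < d) (lam : Fin d → ℝ)
    (hpos : ∀ i, 0 < lam i) (hanti : Antitone lam) (hsum : ∑ i, lam i = 1)
    (lamMin : ℝ) (hmin : lamMin = lam ⟨d - 1, Nat.sub_one_lt_of_lt hd⟩)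
    (a : ℝ) (ha : a = (d : ℝ) / 4 * lamMin)
    (z : Fin d → ℝ)
    (hz : ∀ i, z i = 1 / ((d : ℝ) + 1) * (√lamMin / 2) * (√(lam i) - 1 / 2 * √lamMin)) :
    -- `Q` is a correlation, and the inequality holds, with equality exactly at `Q`
    SemiSelfTest.IsCorrelation (SemiSelfTest.corrQ d a z) ∧
    (∀ P : Matrix (SemiSelfTest.Outcome d) (SemiSelfTest.Outcome d) ℝ,
      SemiSelfTest.IsCorrelation P →
        ∑ x, ∑ y, √(P x y) * √(SemiSelfTest.corrQ d a z x y) ≤ 1 ∧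
        (∑ x, ∑ y, √(P x y) * √(SemiSelfTest.corrQ d a z x y) = 1 ↔
          P = SemiSelfTest.corrQ d a z)) ∧
    -- every pure state with Schmidt coefficients `√λ_i` generates `Q`
    (∀ ρ : Matrix (Fin d × Fin d) (Fin d × Fin d) ℂ,
      SemiSelfTest.IsPureWithSchmidtCoefficients ρ (fun i => √(lam i)) →
        ∃ A B : SemiSelfTest.Outcome d → Matrix (Fin d) (Fin d) ℂ,
          SemiSelfTest.IsPOVM A ∧ SemiSelfTest.IsPOVM B ∧
          SemiSelfTest.correlation ρ A B = SemiSelfTest.corrQ d a z) ∧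
    -- only such states saturate the inequality
    (∀ (ρ : Matrix (Fin d × Fin d) (Fin d × Fin d) ℂ)
      (A B : SemiSelfTest.Outcome d → Matrix (Fin d) (Fin d) ℂ),
      SemiSelfTest.IsState ρ → SemiSelfTest.IsPOVM A → SemiSelfTest.IsPOVM B →
      ∑ x, ∑ y, √(SemiSelfTest.correlation ρ A B x y) * √(SemiSelfTest.corrQ d a z x y) = 1 →
        SemiSelfTest.IsPureWithSchmidtCoefficients ρ (fun i => √(lam i))) := by
  have hd' : (0 : ℝ) < d := by exact_mod_cast hd
  have hlm : 0 < lamMin := hmin ▸ hpos _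
  obtain ⟨r, hrdef⟩ : ∃ r, r = √lamMin / 2 := ⟨_, rfl⟩
  have hr : 0 < r := by rw [hrdef]; positivity
  have hr2 : lamMin = 4 * r ^ 2 := by rw [hrdef, div_pow, Real.sq_sqrt hlm.le]; ring
  obtain ⟨s, hs⟩ : ∃ s : Fin d → ℝ, s = fun i => √(lam i) := ⟨_, rfl⟩
  have hrs : ∀ i, r < s i := fun i => by
    have h1 : lamMin ≤ lam i := hmin ▸ hanti (Fin.le_def.2 (Nat.le_sub_one_of_lt i.2))
    have h2 : √lamMin ≤ √(lam i) := Real.sqrt_le_sqrt h1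
    rw [hs]
    simp only
    linarith
  have ha' : a = d * r ^ 2 := by rw [ha, hr2]; ring
  have hz' : z = fun i => 1 / ((d : ℝ) + 1) * r * (s i - r) := by
    ext i
    rw [hz, hs, hrdef]
    ring
  have hs2 : ∑ i, s i ^ 2 = 1 := by
    rw [← hsum, hs]
    exact Finset.sum_congr rfl fun i _ => Real.sq_sqrt (hpos i).le
  rw [ha', hz', ← hs]
  have hQ : SemiSelfTest.IsCorrelation (SemiSelfTest.corrQ d (d * r ^ 2)
      fun i => 1 / ((d : ℝ) + 1) * r * (s i - r)) := by
    refine ⟨SemiSelfTest.corrQ_nonneg _ _ (by positivity) fun i => ?_, ?_⟩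
    · have := sub_pos.2 (hrs i)
      positivity
    -- The total is `∑ (r² + 2 r (s i - r) + (s i - r)²) = ∑ s i ^ 2`.
    · rw [SemiSelfTest.sum_corrQ _ _ hd]
      simp only [mul_pow, ← Finset.mul_sum, sub_sq, Finset.sum_add_distrib,
        Finset.sum_sub_distrib, hs2, Finset.sum_const, Finset.card_univ, Fintype.card_fin,
        nsmul_eq_mul, mul_right_comm _ _ r]
      field_simp
      ring
  refine ⟨hQ, fun P hP => hP.sum_sqrt_mul_sqrt_le_one hQ, fun ρ hρ =>
    SemiSelfTest.exists_povm_correlation_eq hd hr (fun i => (hrs i).le) hρ,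
    fun ρ A B hρ hA hB h => ?_⟩
  have hcorr := ((SemiSelfTest.isCorrelation_correlation hρ hA hB).sum_sqrt_mul_sqrt_le_one
    hQ).2.1 h
  refine SemiSelfTest.isPureWithSchmidtCoefficients_of_trace_eq_corrQ hd hr hrs hρ.1 hA hB
    fun x y => ?_
  rw [← SemiSelfTest.ofReal_correlation hρ.1 hA.1 hB.1, hcorr]
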